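/- Let $\mathbb I=[0,1]$. A (bivariate) copula is a function $C:\mathbb I^2\to\mathbb R$ with $C(u,0)=C(0,v)=0$, $C(u,1)=u$, $C(1,v)=v$ and $C(u_2,v_2)-C(u_1,v_2)-C(u_2,v_1)+C(u_1,v_1)\ge 0$ whenever $u_1\le u_2$, $v_1\le v_2$. A quasi-copula is a function $Q:\mathbb I^2\to\mathbb R$ with the same boundary conditions that is increasing in each variable and satisfies $|Q(u_2,v_2)-Q(u_1,v_1)|\le|u_2-u_1|+|v_2-v_1|$; it is proper if it is not a copula. Put $M(u,v)=\min\{u,v\}$ and $\widehat Q(u,v)=u+v-1+Q(1-u,1-v)$; in the concordance order, $Q$ precedes $R$ if $Q\le R$ and $\widehat Q\le\widehat R$ pointwise on $\mathbb I^2$. The shuffle of $M$ denoted $M(n,\{J_1,\dots,J_n\},\pi,\omega)$ is the copula whose mass is spread uniformly along the graph of the piecewise linear rearrangement of $\mathbb I$ which moves the consecutive closed interval $J_i$ to the position $\pi(i)$, by a translation if $\omega(i)=1$ and with a flip if $\omega(i)=-1$. Spearman's footrule of a copula, extended by the same formula to quasi-copulas, is $$\phi(Q)=6\int_0^1 Q(t,t)\,dt-2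 .$$ For $\phi\in[-\frac12,1]$ let $\overline F_\phi(a,b)=\sup\{C(a,b): C\text{ is a copula with }\phi(C)=\phi\}$, $(a,b)\in\mathbb I^2$ (the set of these copulas is nonempty, so that this is a supremum of a nonempty bounded set). Then: (i) $\overline F_{-1/2}$ is a shuffle of $M$, namely $\overline F_{-1/2}=M(2,\{[0,\frac12],[\frac12,1]\},(2,1),1)$, and $\overline F_\phi=M$ for all $\phi\in[\frac14,1]$. (ii) For $\phi\in(-\frac12,\frac14)$ the bound $\overline F_\phi$ is not a copula, but a proper quasi-copula. (iii) $\overline F_\phi$ is increasing in $\phi\in[-\frac12,1]$ in the concordance order: if $\phi_1\le\phi_2$, then $\overline F_{\phi_1}$ precedes $\overline F_{\phi_2}$. (iv) For all $\phi\in[-\frac12,1]$, $\overline F_\phi$ is symmetric and radially symmetric: $\overline F_\phi(a,b)=\overline F_\phi(b,a)$ and $\overline F_\phi(a,b)=\widehat{\overline F}_\phi(a,b)$ on $\mathbb I^2$. (v) $\phi(\overline F_{-1/2})=-\frac12$, $$\phi(\overline F_\phi)=\frac12\left(2-\sqrt{3-12\phi}+(1+2\phi)\log\frac{\left(3+\sqrt{3-12\phi}\right)^2}{6(1+2\phi)}\right)\quad\text{for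 }-\tfrac12<\phi\le\tfrac14,$$ and $\phi(\overline F_\phi)=1$ for $\frac14\le\phi\le1$. In particular $\phi(\overline F_\phi)>\phi$ for all $\phi\in(0,1)$. -/

import Mathlib

noncomputable section

namespace FootruleBounds

open MeasureTheory unitInterval

/-- A bivariate copula on the unit square: grounded, with uniform margins, and 2-increasing. -/
structure IsCopula (C : unitInterval → unitInterval → ℝ) : Prop where
  zero_left : ∀ v, C 0 v = 0
  zero_right : ∀ u, C u 0 = 0
  one_left : ∀ v, C 1 v = v
  one_right : ∀ u, C u 1 = u
  two_increasing : ∀ u₁ u₂ v₁ v₂, u₁ ≤ u₂ → v₁ ≤ v₂ →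
    0 ≤ C u₂ v₂ - C u₁ v₂ - C u₂ v₁ + C u₁ v₁

/-- A bivariate quasi-copula: grounded, with uniform margins, increasing in each variable, and
1-Lipschitz with respect to the sum of the coordinate distances. -/
structure IsQuasiCopula (Q : unitInterval → unitInterval → ℝ) : Prop where
  zero_left : ∀ v, Q 0 v = 0
  zero_right : ∀ u, Q u 0 = 0
  one_left : ∀ v, Q 1 v = v
  one_right : ∀ u, Q u 1 = u
  mono : ∀ u₁ u₂ v₁ v₂, u₁ ≤ u₂ → v₁ ≤ v₂ → Q u₁ v₁ ≤ Q u₂ v₂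
  lipschitz : ∀ u₁ u₂ v₁ v₂,
    |Q u₂ v₂ - Q u₁ v₁| ≤ |(u₂ : ℝ) - u₁| + |(v₂ : ℝ) - v₁|

/-- A quasi-copula that is not a copula. -/
def IsProperQuasiCopula (Q : unitInterval → unitInterval → ℝ) : Prop :=
  IsQuasiCopula Q ∧ ¬ IsCopula Q

/-- The Fréchet-Hoeffding upper bound `M(u,v) = min{u,v}`. -/
def frechetM : unitInterval → unitInterval → ℝ := fun u v => min (u : ℝ) (v : ℝ)

/-- The transpose `Cᵗ(u,v) = C(v,u)`. -/
def transpose (C : unitInterval → unitInterval → ℝ) : unitInterval → unitInterval → ℝ :=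
  fun u v => C v u

/-- The reflection `v - C(1-u,v)`. -/
def reflectOne (C : unitInterval → unitInterval → ℝ) : unitInterval → unitInterval → ℝ :=
  fun u v => (v : ℝ) - C (σ u) v

/-- The reflection `u - C(u,1-v)`. -/
def reflectTwo (C : unitInterval → unitInterval → ℝ) : unitInterval → unitInterval → ℝ :=
  fun u v => (u : ℝ) - C u (σ v)

/-- The survival transform, `(u,v) ↦ u + v - 1 + C(1-u,1-v)`. -/
def survival (C : unitInterval → unitInterval → ℝ) : unitInterval → unitInterval → ℝ :=
  reflectTwo (reflectOne C)

/-- The concordance order. -/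
def ConcordanceLE (C D : unitInterval → unitInterval → ℝ) : Prop :=
  (∀ u v, C u v ≤ D u v) ∧ (∀ u v, survival C u v ≤ survival D u v)

/-- Spearman's footrule `6 ∫₀¹ C(t,t) dt - 2`, for copulas and, by the same formula, for
quasi-copulas. -/
def footrule (C : unitInterval → unitInterval → ℝ) : ℝ :=
  6 * (∫ t : unitInterval, C t t) - 2

/-- The set of all copulas whose Spearman's footrule equals `φ`. -/
def footruleClass (φ : ℝ) : Set (unitInterval → unitInterval → ℝ) :=
  {C | IsCopula C ∧ footrule C = φ}

/-- The values at the point `(a,b)` of the copulas with Spearman's footrule `φ`. -/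
def footruleValues (φ : ℝ) (a b : unitInterval) : Set ℝ :=
  (fun C : unitInterval → unitInterval → ℝ => C a b) '' footruleClass φ

/-- The pointwise supremum of the copulas with Spearman's footrule `φ`. -/
def upperBoundF (φ : ℝ) : unitInterval → unitInterval → ℝ :=
  fun a b => sSup (footruleValues φ a b)

/-- The points `s 0 < s 1 < ⋯ < s n` cut `[0,1]` into the `n` closed intervals
`J i = [s i, s (i+1)]`. -/
structure IsCut {n : ℕ} (s : Fin (n + 1) → ℝ) : Prop where
  strictMono : StrictMono s
  first : s 0 = 0
  last : s (Fin.last n) = 1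

/-- The left end point of the interval onto which `J i` is moved, when the intervals are
rearranged so that `J i` comes to the position `π i`. -/
def shuffledStart {n : ℕ} (s : Fin (n + 1) → ℝ) (π : Equiv.Perm (Fin n)) (i : Fin n) : ℝ :=
  ∑ j with π j < π i, (s j.succ - s j.castSucc)

/-- The map that moves `J i` to its new place, by a translation if `ω i = 1` and with a flip if
`ω i = -1`. -/
def shuffleMap {n : ℕ} (s : Fin (n + 1) → ℝ) (π : Equiv.Perm (Fin n)) (ω : Fin n → ℤˣ)
    (i : Fin n) (x : ℝ) : ℝ :=
  if ω i = 1 then shuffledStart s π i + (x - s i.castSucc)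
  else shuffledStart s π i + (s i.succ - x)

/-- The shuffle of `M` given by `(n, {J i}, π, ω)`: the distribution function of the mass that is
spread uniformly (with respect to `x`) on the graph of the rearrangement of the intervals. -/
def shuffleOfM {n : ℕ} (s : Fin (n + 1) → ℝ) (π : Equiv.Perm (Fin n)) (ω : Fin n → ℤˣ) :
    unitInterval → unitInterval → ℝ :=
  fun u v => ∑ i, (volume : Measure ℝ).real
    {x : ℝ | x ∈ Set.Icc (s i.castSucc) (s i.succ) ∧ x ≤ u ∧ shuffleMap s π ω i x ≤ v}

/-- Being a shuffle of `M`. -/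
def IsShuffleOfM (C : unitInterval → unitInterval → ℝ) : Prop :=
  ∃ (n : ℕ) (s : Fin (n + 1) → ℝ) (π : Equiv.Perm (Fin n)) (ω : Fin n → ℤˣ),
    IsCut s ∧ C = shuffleOfM s π ω

end FootruleBounds

end

namespace FootruleBounds

open MeasureTheory unitInterval

/-! ### Elementary properties of copulas -/

namespace IsCopula

variable {C D : unitInterval → unitInterval → ℝ}

/-! Among the copulas with value `d` at `(a,b)` there is a least one, `localLower a b d`, by
monotonicity and the Lipschitz property. Since the footrule is monotone, a copula with footrule `φ`
can take the value `d` at `(a,b)` only if `footrule (localLower a b d) ≤ φ`. Conversely, mixing with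
the largest copula `M`, whose footrule is 1, raises the footrule to any prescribed larger `φ ≤ 1`
and lowers no value. Hence "footrule equal to `φ`" may be replaced by "at most `φ`" in the supremum
(`le_upperBoundF`).

The footrule of `localLower a b d` is quadratic in `d` for `(a,b)` near the diagonal
(`footrule_localLower`). At `b = a` the condition is `d * (1 + d - 2 * a) ≤ (1 + 2φ) / 6`, which
gives the diagonal of the bound exactly (`upperBoundF_diag`). Everything else follows from this
diagonal, from the symmetries of the class and from lower estimates off the diagonal: for `φ ≥ 1/4`
the diagonal is that of `M`, for `φ = -1/2` it is that of `W(u,v) = max{0, u+v-1}`, and in between a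
small square centred at `(1/2,1/2)` has negative volume. The footrule of the bound is the integral
of its diagonal. -/

theorem mono_left (h : IsCopula C) {u₁ u₂ : unitInterval} (hu : u₁ ≤ u₂) (v : unitInterval) :
    C u₁ v ≤ C u₂ v := by
  have := h.two_increasing u₁ u₂ 0 v hu bot_le
  rw [h.zero_right, h.zero_right] at this
  linarith

theorem mono_right (h : IsCopula C) (u : unitInterval) {v₁ v₂ : unitInterval} (hv : v₁ ≤ v₂) :
    C u v₁ ≤ C u v₂ := by
  have := h.two_increasing 0 u v₁ v₂ bot_le hv
  rw [h.zero_left, h.zero_left] at this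
  linarith

theorem le_add_left (h : IsCopula C) {u₁ u₂ : unitInterval} (hu : u₁ ≤ u₂) (v : unitInterval) :
    C u₂ v ≤ C u₁ v + (u₂ - u₁) := by
  have := h.two_increasing u₁ u₂ v 1 hu le_top
  rw [h.one_right, h.one_right] at this
  linarith

theorem le_add_right (h : IsCopula C) (u : unitInterval) {v₁ v₂ : unitInterval} (hv : v₁ ≤ v₂) :
    C u v₂ ≤ C u v₁ + (v₂ - v₁) := by
  have := h.two_increasing u 1 v₁ v₂ le_top hv
  rw [h.one_left, h.one_left] at this
  linarith

/-- A one-sided estimate that contains both monotonicity and the Lipschitz property. Being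
one-sided, it yields `localLower_le` at once and passes to suprema. -/
theorem le_add_max (h : IsCopula C) (u₁ u₂ v₁ v₂ : unitInterval) :
    C u₂ v₂ ≤ C u₁ v₁ + max 0 ((u₂ : ℝ) - u₁) + max 0 ((v₂ : ℝ) - v₁) := by
  have h₁ : C u₂ v₂ ≤ C u₁ v₂ + max 0 ((u₂ : ℝ) - u₁) := by
    rcases le_total u₁ u₂ with hu | hu
    · linarith [h.le_add_left hu v₂, le_max_right 0 ((u₂ : ℝ) - u₁)]
    · linarith [h.mono_left hu v₂, le_max_left 0 ((u₂ : ℝ) - u₁)]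
  have h₂ : C u₁ v₂ ≤ C u₁ v₁ + max 0 ((v₂ : ℝ) - v₁) := by
    rcases le_total v₁ v₂ with hv | hv
    · linarith [h.le_add_right u₁ hv, le_max_right 0 ((v₂ : ℝ) - v₁)]
    · linarith [h.mono_right u₁ hv, le_max_left 0 ((v₂ : ℝ) - v₁)]
  linarith

theorem nonneg (h : IsCopula C) (u v : unitInterval) : 0 ≤ C u v := by
  simpa [h.zero_left] using h.mono_left (unitInterval.nonneg' : 0 ≤ u) v

theorem add_sub_one_le (h : IsCopula C) (u v : unitInterval) : (u : ℝ) + v - 1 ≤ C u v := by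
  have := h.le_add_left (le_one' : u ≤ 1) v
  rw [h.one_left] at this
  simp only [Set.Icc.coe_one] at this
  linarith

theorem le_left (h : IsCopula C) (u v : unitInterval) : C u v ≤ u := by
  simpa [h.one_right] using h.mono_right u (le_one' : v ≤ 1)

theorem le_right (h : IsCopula C) (u v : unitInterval) : C u v ≤ v := by
  simpa [h.one_left] using h.mono_left (le_one' : u ≤ 1) v

theorem abs_sub_le (h : IsCopula C) (u₁ u₂ v₁ v₂ : unitInterval) :
    |C u₂ v₂ - C u₁ v₁| ≤ |(u₂ : ℝ) - u₁| + |(v₂ : ℝ) - v₁| := by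
  have aux : ∀ x y : ℝ, max 0 (x - y) ≤ |x - y| := fun x y =>
    max_le (abs_nonneg _) (le_abs_self _)
  rw [abs_le]
  constructor
  · have := h.le_add_max u₂ u₁ v₂ v₁
    have h₁ := aux (u₁ : ℝ) u₂
    have h₂ := aux (v₁ : ℝ) v₂
    rw [abs_sub_comm] at h₁ h₂
    linarith
  · linarith [h.le_add_max u₁ u₂ v₁ v₂, aux (u₂ : ℝ) u₁, aux (v₂ : ℝ) v₁]

theorem continuous_diag (h : IsCopula C) : Continuous fun t => C t t := by
  have : LipschitzWith 2 fun t => C t t := by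
    refine LipschitzWith.of_dist_le_mul fun x y => ?_
    rw [Real.dist_eq, Subtype.dist_eq, Real.dist_eq]
    have := h.abs_sub_le y x y x
    simp only [NNReal.coe_ofNat]
    linarith
  exact this.continuous

theorem integrable_diag (h : IsCopula C) : Integrable fun t => C t t :=
  h.continuous_diag.integrable_of_hasCompactSupport
    (HasCompactSupport.of_compactSpace _)

theorem mix (hC : IsCopula C) (hD : IsCopula D) {w : ℝ} (hw : w ∈ Set.Icc (0 : ℝ) 1) :
    IsCopula fun u v => (1 - w) * C u v + w * D u v where
  zero_left v := by simp [hC.zero_left, hD.zero_left]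
  zero_right v := by simp [hC.zero_right, hD.zero_right]
  one_left v := by rw [hC.one_left, hD.one_left]; ring
  one_right v := by rw [hC.one_right, hD.one_right]; ring
  two_increasing u₁ u₂ v₁ v₂ hu hv := by
    have h₁ := mul_nonneg (sub_nonneg.2 hw.2) (hC.two_increasing u₁ u₂ v₁ v₂ hu hv)
    have h₂ := mul_nonneg hw.1 (hD.two_increasing u₁ u₂ v₁ v₂ hu hv)
    linarith

theorem footrule_mix (hC : IsCopula C) (hD : IsCopula D) (w : ℝ) :
    footrule (fun u v => (1 - w) * C u v + w * D u v) =
      (1 - w) * footrule C + w * footrule D := by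
  unfold footrule
  rw [integral_add (hC.integrable_diag.const_mul _) (hD.integrable_diag.const_mul _),
    integral_const_mul, integral_const_mul]
  ring

theorem transpose (h : IsCopula C) : IsCopula (transpose C) where
  zero_left v := h.zero_right v
  zero_right v := h.zero_left v
  one_left v := h.one_right v
  one_right v := h.one_left v
  two_increasing u₁ u₂ v₁ v₂ hu hv := by
    have := h.two_increasing v₁ v₂ u₁ u₂ hv hu
    simp only [FootruleBounds.transpose]
    linarith

end IsCopula

theorem survival_apply (C : unitInterval → unitInterval → ℝ) (u v : unitInterval) :
    survival C u v = u + v - 1 + C (σ u) (σ v) := by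
  simp only [survival, reflectTwo, reflectOne, coe_symm_eq]
  ring

theorem isCopula_survival {C : unitInterval → unitInterval → ℝ} (h : IsCopula C) :
    IsCopula (survival C) where
  zero_left v := by simp [survival_apply, h.one_left]
  zero_right v := by simp [survival_apply, h.one_right]
  one_left v := by simp [survival_apply, h.zero_left]
  one_right v := by simp [survival_apply, h.zero_right]
  two_increasing u₁ u₂ v₁ v₂ hu hv := by
    have := h.two_increasing (σ u₂) (σ u₁) (σ v₂) (σ v₁) (symm_le_symm.2 hu) (symm_le_symm.2 hv)
    simp only [survival_apply]
    linarith

/-! ### The footrule as an interval integral -/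

theorem integral_unitInterval_eq (g : ℝ → ℝ) :
    ∫ t : unitInterval, g t = ∫ t in (0 : ℝ)..1, g t := by
  rw [intervalIntegral.integral_of_le zero_le_one, ← integral_Icc_eq_integral_Ioc]
  exact integral_subtype measurableSet_Icc g

theorem footrule_eq_intervalIntegral {C : unitInterval → unitInterval → ℝ} {g : ℝ → ℝ}
    (h : ∀ t : unitInterval, C t t = g t) :
    footrule C = 6 * (∫ t in (0 : ℝ)..1, g t) - 2 := by
  unfold footrule
  rw [← integral_unitInterval_eq]
  simp only [h]

theorem footrule_transpose (C : unitInterval → unitInterval → ℝ) :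
    footrule (transpose C) = footrule C := rfl

theorem IsCopula.footrule_survival {C : unitInterval → unitInterval → ℝ} (h : IsCopula C) :
    footrule (survival C) = footrule C := by
  have h₁ : ∫ t : unitInterval, C (σ t) (σ t) = ∫ t : unitInterval, C t t :=
    measurePreserving_symm.integral_comp symmMeasurableEquiv.measurableEmbedding
      (fun t => C t t)
  -- The affine part of the survival transform integrates to zero along the diagonal, and `σ`
  -- preserves the measure.
  have h₂ : ∫ t : unitInterval, ((t : ℝ) + t - 1) = 0 := by
    rw [integral_unitInterval_eq (fun t => t + t - 1)]
    rw [intervalIntegral.integral_sub (by simp) (by simp),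
      intervalIntegral.integral_add (by simp) (by simp)]
    norm_num
  have hi : Integrable fun t : unitInterval => ((t : ℝ) + t - 1) :=
    Continuous.integrable_of_hasCompactSupport (by fun_prop)
      (HasCompactSupport.of_compactSpace _)
  have hj : Integrable fun t : unitInterval => C (σ t) (σ t) :=
    (h.continuous_diag.comp continuous_symm).integrable_of_hasCompactSupport
      (HasCompactSupport.of_compactSpace _)
  unfold footrule
  simp only [survival_apply]
  rw [integral_add hi hj, h₁, h₂, zero_add]

theorem IsCopula.footrule_mono {C D : unitInterval → unitInterval → ℝ} (hC : IsCopula C)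
    (hD : IsCopula D) (h : ∀ t, C t t ≤ D t t) : footrule C ≤ footrule D := by
  have := integral_mono hC.integrable_diag hD.integrable_diag h
  unfold footrule
  linarith

/-! ### The upper Fréchet-Hoeffding bound -/

/-- Functions of the form `min (f u) (g v)` with increasing `f`, `g` are 2-increasing. -/
theorem two_increasing_min {x₁ x₂ y₁ y₂ : ℝ} (hx : x₁ ≤ x₂) (hy : y₁ ≤ y₂) :
    0 ≤ min x₂ y₂ - min x₁ y₂ - min x₂ y₁ + min x₁ y₁ := by
  rcases le_total x₁ y₁ with h | h <;> rcases le_total x₂ y₂ with h' | h' <;>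
  rcases le_total x₁ y₂ with h'' | h'' <;> rcases le_total x₂ y₁ with h₃ | h₃ <;>
  simp only [min_eq_left, min_eq_right, *] <;> linarith

theorem isCopula_frechetM : IsCopula frechetM where
  zero_left v := by simp [frechetM, v.2.1]
  zero_right v := by simp [frechetM, v.2.1]
  one_left v := by simp [frechetM, v.2.2]
  one_right v := by simp [frechetM, v.2.2]
  two_increasing u₁ u₂ v₁ v₂ hu hv := two_increasing_min (by exact_mod_cast hu)
    (by exact_mod_cast hv)

theorem footrule_frechetM : footrule frechetM = 1 := by
  rw [footrule_eq_intervalIntegral (g := fun t => t) (fun t => by simp [frechetM])]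
  norm_num

/-! ### The smallest copula with a given value at a given point -/

/-- The smallest copula that takes the value `d` at `(a,b)`. -/
def localLower (a b d : ℝ) : unitInterval → unitInterval → ℝ := fun u v =>
  max (max 0 ((u : ℝ) + v - 1)) (d - max 0 (a - u) - max 0 (b - v))

theorem IsCopula.localLower_le {C : unitInterval → unitInterval → ℝ} (h : IsCopula C)
    (a b u v : unitInterval) : localLower a b (C a b) u v ≤ C u v := by
  refine max_le (max_le (h.nonneg u v) (h.add_sub_one_le u v)) ?_
  linarith [h.le_add_max u a v b]

/-- To bound a sum of two maxima by the sum of two others, compare the branches. -/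
theorem two_increasing_max {x y z x' y' z' p q r p' q' r' : ℝ}
    (h : ∀ R S, p ≤ R → q ≤ R → r ≤ R → p' ≤ S → q' ≤ S → r' ≤ S →
      (x + x' ≤ R + S ∧ x + y' ≤ R + S ∧ x + z' ≤ R + S) ∧
      (y + x' ≤ R + S ∧ y + y' ≤ R + S ∧ y + z' ≤ R + S) ∧
      (z + x' ≤ R + S ∧ z + y' ≤ R + S ∧ z + z' ≤ R + S)) :
    0 ≤ max (max p q) r - max (max x y) z - max (max x' y') z' + max (max p' q') r' := by
  obtain ⟨⟨a₁, a₂, a₃⟩, ⟨b₁, b₂, b₃⟩, c₁, c₂, c₃⟩ := h (max (max p q) r) (max (max p' q') r')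
    (by simp) (by simp) (by simp) (by simp) (by simp) (by simp)
  rcases max_choice (max x y) z with h₁ | h₁ <;> rcases max_choice x y with h₂ | h₂ <;>
  rcases max_choice (max x' y') z' with h₃ | h₃ <;> rcases max_choice x' y' with h₄ | h₄ <;>
  rw [h₁, h₃] <;> (try simp only [h₂, h₄]) <;> linarith

theorem isCopula_localLower {a b d : ℝ} (h₀ : 0 ≤ d) (ha : d ≤ a) (hb : d ≤ b)
    (ha' : a ≤ 1) (hb' : b ≤ 1) : IsCopula (localLower a b d) where
  zero_left v := by
    have hv := v.2
    have := max_eq_right (sub_nonneg.2 (h₀.trans ha))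
    simp only [localLower, Set.Icc.coe_zero, this]
    rw [max_eq_left (by linarith [hv.2] : (0 : ℝ) + v - 1 ≤ 0),
      max_eq_left (by linarith [le_max_left 0 (b - v)])]
  zero_right u := by
    have hu := u.2
    have := max_eq_right (sub_nonneg.2 (h₀.trans hb))
    simp only [localLower, Set.Icc.coe_zero, this]
    rw [max_eq_left (by linarith [hu.2] : (u : ℝ) + 0 - 1 ≤ 0),
      max_eq_left (by linarith [le_max_left 0 (a - u)])]
  one_left v := by
    have hv := v.2
    have := max_eq_left (sub_nonpos.2 ha')
    simp only [localLower, Set.Icc.coe_one, this]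
    rw [max_eq_right (by linarith [hv.1] : (0 : ℝ) ≤ 1 + v - 1), max_eq_left]
    · ring
    · linarith [le_max_right 0 (b - v)]
  one_right u := by
    have hu := u.2
    have := max_eq_left (sub_nonpos.2 hb')
    simp only [localLower, Set.Icc.coe_one, this]
    rw [max_eq_right (by linarith [hu.1] : (0 : ℝ) ≤ u + 1 - 1), max_eq_left]
    · ring
    · linarith [le_max_right 0 (a - u)]
  two_increasing u₁ u₂ v₁ v₂ hu hv := by
    have hu' : (u₁ : ℝ) ≤ u₂ := by exact_mod_cast hu
    have hv' : (v₁ : ℝ) ≤ v₂ := by exact_mod_cast hv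
    simp only [localLower]
    generalize (u₁ : ℝ) = x₁ at *
    generalize (u₂ : ℝ) = x₂ at *
    generalize (v₁ : ℝ) = y₁ at *
    generalize (v₂ : ℝ) = y₂ at *
    have pos : ∀ {c x : ℝ}, x ≤ c → max 0 (c - x) = c - x := fun h => max_eq_right (by linarith)
    have neg : ∀ {c x : ℝ}, c ≤ x → max 0 (c - x) = 0 := fun h => max_eq_left (by linarith)
    -- Once the positions relative to `a` and `b` are fixed, the inner maxima are affine and only
    -- the nine pairs of outer branches remain.
    rcases le_total x₁ a with h₂ | h₂ <;> rcases le_total x₂ a with h₃ | h₃ <;>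
    rcases le_total y₁ b with h₄ | h₄ <;> rcases le_total y₂ b with h₅ | h₅ <;>
    simp only [*] <;>
    refine two_increasing_max fun R S _ _ _ _ _ _ => ⟨⟨?_, ?_, ?_⟩, ⟨?_, ?_, ?_⟩, ?_, ?_, ?_⟩ <;>
    linarith

/-! ### The footrule of the smallest copula with a given value at a given point -/

theorem localLower_diag (a b d : ℝ) (t : unitInterval) : localLower a b d t t =
    max (max 0 ((t : ℝ) + t - 1)) (d - max 0 (a - t) - max 0 (b - t)) := rfl

theorem integral_eq_of_eqOn_Icc {f g G : ℝ → ℝ} {p q : ℝ} (hpq : p ≤ q)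
    (h : ∀ t ∈ Set.Icc p q, f t = g t) (hg : Continuous g) (hG : ∀ t, HasDerivAt G (g t) t) :
    ∫ t in p..q, f t = G q - G p := by
  rw [intervalIntegral.integral_congr (g := g) (by rwa [Set.uIcc_of_le hpq])]
  exact intervalIntegral.integral_eq_sub_of_hasDerivAt (fun t _ => hG t)
    (hg.intervalIntegrable _ _)

theorem hasDerivAt_quadratic (m c t : ℝ) :
    HasDerivAt (fun t : ℝ => m / 2 * t ^ 2 + c * t) (m * t + c) t := by
  have := ((hasDerivAt_pow 2 t).const_mul (m / 2)).add ((hasDerivAt_id t).const_mul c)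
  refine this.congr_deriv ?_
  push_cast
  ring

theorem integral_eq_of_eqOn_affine {f : ℝ → ℝ} {p q : ℝ} (m c : ℝ) (hpq : p ≤ q)
    (h : ∀ t ∈ Set.Icc p q, f t = m * t + c) :
    ∫ t in p..q, f t = m / 2 * q ^ 2 + c * q - (m / 2 * p ^ 2 + c * p) :=
  integral_eq_of_eqOn_Icc hpq h (by fun_prop) (hasDerivAt_quadratic m c)

/-- The diagonal section is piecewise affine: 0 up to `(a+b-d)/2`, slope 2 up to `a`, slope 1 up to
`b`, constant `d` up to `(1+d)/2`, and slope 2 up to 1. The hypotheses `hd` and `hd'` put these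
breakpoints in this order. -/
theorem footrule_localLower {a b d : ℝ} (hab : a ≤ b) (h₀ : 0 ≤ d) (h₁ : a + b - 1 ≤ d)
    (ha : d ≤ a) (hd : b - a ≤ d) (hd' : 2 * b - 1 ≤ d) :
    footrule (localLower a b d) =
      3 * (d * (1 + d - a - b) - (b - a) ^ 2 / 2) - 1 / 2 := by
  set g : ℝ → ℝ := fun t => max (max 0 (t + t - 1)) (d - max 0 (a - t) - max 0 (b - t)) with hg
  rw [footrule_eq_intervalIntegral (g := g) (localLower_diag a b d)]
  have hc : Continuous g := by fun_prop
  have hi : ∀ p q, IntervalIntegrable g volume p q := fun p q => hc.intervalIntegrable p q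
  have pos : ∀ {c x : ℝ}, x ≤ c → max 0 (c - x) = c - x := fun h => max_eq_right (by linarith)
  have neg : ∀ {c x : ℝ}, c ≤ x → max 0 (c - x) = 0 := fun h => max_eq_left (by linarith)
  have e₁ : ∫ t in (0 : ℝ)..((a + b - d) / 2), g t = 0 := by
    rw [integral_eq_of_eqOn_affine 0 0 (by linarith)]
    · ring
    · rintro t ⟨ht, ht'⟩
      simp only [hg]
      rw [pos (by linarith : t ≤ a),
        pos (by linarith : t ≤ b), max_eq_left (by linarith : t + t - 1 ≤ 0),
        max_eq_left (by linarith)]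
      ring
  have e₂ := integral_eq_of_eqOn_affine (f := g) (p := (a + b - d) / 2) (q := a) 2 (d - a - b)
    (by linarith) (by
      rintro t ⟨ht, ht'⟩
      simp only [hg]
      rw [pos (by linarith : t ≤ a),
        pos (by linarith : t ≤ b), max_eq_right]
      · ring
      · exact max_le (by linarith) (by linarith))
  have e₃ := integral_eq_of_eqOn_affine (f := g) (p := a) (q := b) 1 (d - b) hab (by
      rintro t ⟨ht, ht'⟩
      simp only [hg]
      rw [neg (by linarith : a ≤ t),
        pos (by linarith : t ≤ b), max_eq_right]
      · ring
      · exact max_le (by linarith) (by linarith))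
  have e₄ := integral_eq_of_eqOn_affine (f := g) (p := b) (q := (1 + d) / 2) 0 d
    (by linarith) (by
      rintro t ⟨ht, ht'⟩
      simp only [hg]
      rw [neg (by linarith : a ≤ t),
        neg (by linarith : b ≤ t), max_eq_right]
      · ring
      · exact max_le (by linarith) (by linarith))
  have e₅ := integral_eq_of_eqOn_affine (f := g) (p := (1 + d) / 2) (q := 1) 2 (-1)
    (by linarith) (by
      rintro t ⟨ht, ht'⟩
      simp only [hg]
      rw [neg (by linarith : a ≤ t),
        neg (by linarith : b ≤ t), max_eq_right (by linarith : 0 ≤ t + t - 1),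
        max_eq_left]
      · ring
      · linarith)
  rw [← intervalIntegral.integral_add_adjacent_intervals (hi 0 ((a + b - d) / 2)) (hi _ 1),
    ← intervalIntegral.integral_add_adjacent_intervals (hi _ a) (hi a 1),
    ← intervalIntegral.integral_add_adjacent_intervals (hi _ b) (hi b 1),
    ← intervalIntegral.integral_add_adjacent_intervals (hi _ ((1 + d) / 2)) (hi _ 1),
    e₁, e₂, e₃, e₄, e₅]
  ring

/-- A function that agrees on the diagonal with `W(u,v) = max{0, u+v-1}` has footrule `-1/2`. -/
theorem footrule_eq_of_diag_eq {C : unitInterval → unitInterval → ℝ}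
    (h : ∀ t, C t t = max 0 ((t : ℝ) + t - 1)) : footrule C = -1 / 2 := by
  -- At `a = b = d = 0` the local lower bound is `W` itself.
  have : footrule C = footrule (localLower 0 0 0) := by
    unfold footrule
    simp only [h, localLower_diag]
    congr 3
    ext t
    rw [max_eq_left (a := max 0 _)]
    have h₁ := le_max_left 0 (0 - (t : ℝ))
    have h₂ := le_max_left 0 ((t : ℝ) + t - 1)
    linarith
  rw [this, footrule_localLower] <;> norm_num

/-! ### Values of copulas with a given footrule -/

/-- The restriction that the footrule puts on the diagonal of a copula. -/
theorem IsCopula.diag_mul_le {C : unitInterval → unitInterval → ℝ} (h : IsCopula C)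
    (a : unitInterval) :
    C a a * (1 + C a a - 2 * a) ≤ (1 + 2 * footrule C) / 6 := by
  have h₀ := h.nonneg a a
  have h₁ := h.add_sub_one_le a a
  have h₂ := h.le_left a a
  have hL := isCopula_localLower h₀ h₂ h₂ a.2.2 a.2.2
  have := hL.footrule_mono h fun t => h.localLower_le a a t t
  rw [footrule_localLower le_rfl h₀ h₁ h₂ (by linarith) (by linarith)] at this
  linarith

theorem footruleValues_bddAbove (φ : ℝ) (a b : unitInterval) :
    BddAbove (footruleValues φ a b) := by
  refine ⟨a, ?_⟩
  rintro _ ⟨C, ⟨hC, -⟩, rfl⟩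
  exact hC.le_left a b

/-- A copula with a small footrule can be moved towards `M` until it has the prescribed one. -/
theorem exists_mem_footruleClass {C : unitInterval → unitInterval → ℝ} (hC : IsCopula C) {φ : ℝ}
    (h : footrule C ≤ φ) (h' : φ ≤ 1) : ∃ D ∈ footruleClass φ, ∀ u v, C u v ≤ D u v := by
  obtain ⟨w, hw, hφ⟩ : ∃ w ∈ Set.Icc (0 : ℝ) 1, (1 - w) * footrule C + w * 1 = φ := by
    -- The footrule is affine on the segment from `C` to `M`, so `w` solves a linear equation. It
    -- degenerates when `C` already has footrule 1, hence the separate case.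
    rcases (h.trans h').eq_or_lt with h₁ | h₁
    · exact ⟨0, by simp, by linarith⟩
    · have : 0 < 1 - footrule C := by linarith
      refine ⟨(φ - footrule C) / (1 - footrule C), ⟨div_nonneg (by linarith) this.le,
        (div_le_one this).2 (by linarith)⟩, ?_⟩
      field_simp
      ring
  refine ⟨_, ⟨hC.mix isCopula_frechetM hw, ?_⟩, fun u v => ?_⟩
  · rw [hC.footrule_mix isCopula_frechetM, footrule_frechetM, hφ]
  · have : C u v ≤ frechetM u v := le_min (hC.le_left u v) (hC.le_right u v)
    nlinarith [hw.1]

/-- The form in which competitors are used: only an upper bound on their footrule has to be checked.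
-/
theorem le_upperBoundF {C : unitInterval → unitInterval → ℝ} (hC : IsCopula C) {φ : ℝ}
    (h : footrule C ≤ φ) (h' : φ ≤ 1) (a b : unitInterval) : C a b ≤ upperBoundF φ a b := by
  obtain ⟨D, hD, hle⟩ := exists_mem_footruleClass hC h h'
  exact (hle a b).trans (le_csSup (footruleValues_bddAbove φ a b) ⟨D, hD, rfl⟩)

theorem footruleValues_nonempty {φ : ℝ} (hφ : φ ∈ Set.Icc (-1 / 2 : ℝ) 1) (a b : unitInterval) :
    (footruleValues φ a b).Nonempty := by
  have hL := isCopula_localLower (a := 0) (b := 0) (d := 0) le_rfl le_rfl le_rfl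
    zero_le_one zero_le_one
  obtain ⟨D, hD, -⟩ := exists_mem_footruleClass hL (φ := φ) (by
    rw [footrule_localLower] <;> norm_num
    linarith [hφ.1]) hφ.2
  exact ⟨_, D, hD, rfl⟩

theorem isLUB_upperBoundF {φ : ℝ} (hφ : φ ∈ Set.Icc (-1 / 2 : ℝ) 1) (a b : unitInterval) :
    IsLUB (footruleValues φ a b) (upperBoundF φ a b) :=
  isLUB_csSup (footruleValues_nonempty hφ a b) (footruleValues_bddAbove φ a b)

theorem upperBoundF_le {φ : ℝ} (hφ : φ ∈ Set.Icc (-1 / 2 : ℝ) 1) {a b : unitInterval} {x : ℝ}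
    (h : ∀ C, IsCopula C → footrule C = φ → C a b ≤ x) : upperBoundF φ a b ≤ x := by
  refine (isLUB_upperBoundF hφ a b).2 ?_
  rintro _ ⟨C, ⟨hC, hC'⟩, rfl⟩
  exact h C hC hC'

/-- The competitor is `localLower a b d`; the last hypothesis says that its footrule is at most `φ`.
-/
theorem le_upperBoundF_of_mul_le {φ d : ℝ} (hφ : φ ≤ 1) {a b : unitInterval}
    (hab : (a : ℝ) ≤ b) (h₀ : 0 ≤ d) (h₁ : (a : ℝ) + b - 1 ≤ d) (ha : d ≤ a)
    (hd : (b : ℝ) - a ≤ d) (hd' : 2 * (b : ℝ) - 1 ≤ d)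
    (h : d * (1 + d - a - b) - ((b : ℝ) - a) ^ 2 / 2 ≤ (1 + 2 * φ) / 6) :
    d ≤ upperBoundF φ a b := by
  have hL := isCopula_localLower h₀ ha (ha.trans hab) a.2.2 b.2.2
  have := le_upperBoundF hL (φ := φ) (by
    rw [footrule_localLower hab h₀ h₁ ha hd hd']
    linarith) hφ a b
  refine le_trans ?_ this
  simp [localLower]

theorem upperBoundF_mono {φ₁ φ₂ : ℝ} (h₁ : φ₁ ∈ Set.Icc (-1 / 2 : ℝ) 1) (h₂ : φ₂ ≤ 1)
    (h : φ₁ ≤ φ₂) (a b : unitInterval) : upperBoundF φ₁ a b ≤ upperBoundF φ₂ a b :=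
  upperBoundF_le h₁ fun _ hC hφ => le_upperBoundF hC (hφ.trans_le h) h₂ a b

theorem concordanceLE_upperBoundF {φ₁ φ₂ : ℝ} (h₁ : φ₁ ∈ Set.Icc (-1 / 2 : ℝ) 1) (h₂ : φ₂ ≤ 1)
    (h : φ₁ ≤ φ₂) : ConcordanceLE (upperBoundF φ₁) (upperBoundF φ₂) := by
  refine ⟨upperBoundF_mono h₁ h₂ h, fun u v => ?_⟩
  rw [survival_apply, survival_apply]
  linarith [upperBoundF_mono h₁ h₂ h (σ u) (σ v)]

theorem upperBoundF_le_swap {φ : ℝ} (hφ : φ ∈ Set.Icc (-1 / 2 : ℝ) 1) (a b : unitInterval) :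
    upperBoundF φ a b ≤ upperBoundF φ b a :=
  upperBoundF_le hφ fun C hC h =>
    le_upperBoundF hC.transpose ((footrule_transpose C).trans h).le hφ.2 b a

theorem transpose_upperBoundF {φ : ℝ} (hφ : φ ∈ Set.Icc (-1 / 2 : ℝ) 1) :
    transpose (upperBoundF φ) = upperBoundF φ := by
  ext a b
  exact (upperBoundF_le_swap hφ b a).antisymm (upperBoundF_le_swap hφ a b)

/-- The survival transform maps the class to itself. Being an involution, it turns this inequality
into the equality `survival_upperBoundF`. -/
theorem upperBoundF_le_survival {φ : ℝ} (hφ : φ ∈ Set.Icc (-1 / 2 : ℝ) 1) (a b : unitInterval) :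
    upperBoundF φ a b ≤ survival (upperBoundF φ) a b :=
  upperBoundF_le hφ fun C hC h => by
    have := le_upperBoundF (isCopula_survival hC) (hC.footrule_survival.trans h).le hφ.2 (σ a) (σ b)
    rw [survival_apply, symm_symm, symm_symm, coe_symm_eq, coe_symm_eq] at this
    rw [survival_apply]
    linarith

theorem survival_upperBoundF {φ : ℝ} (hφ : φ ∈ Set.Icc (-1 / 2 : ℝ) 1) :
    survival (upperBoundF φ) = upperBoundF φ := by
  ext a b
  refine le_antisymm ?_ (upperBoundF_le_survival hφ a b)
  have := upperBoundF_le_survival hφ (σ a) (σ b)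
  rw [survival_apply, symm_symm, symm_symm, coe_symm_eq, coe_symm_eq] at this
  rw [survival_apply]
  linarith

theorem isQuasiCopula_upperBoundF {φ : ℝ} (hφ : φ ∈ Set.Icc (-1 / 2 : ℝ) 1) :
    IsQuasiCopula (upperBoundF φ) := by
  have const : ∀ {a b : unitInterval} {x : ℝ}, (∀ C, IsCopula C → C a b = x) →
      upperBoundF φ a b = x := fun {a b x} h => by
    obtain ⟨_, C, ⟨hC, hC'⟩, -⟩ := footruleValues_nonempty hφ a b
    refine le_antisymm (upperBoundF_le hφ fun D hD _ => (h D hD).le) ?_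
    rw [← h C hC]
    exact le_upperBoundF hC hC'.le hφ.2 a b
  -- The one-sided estimate survives the supremum and gives both monotonicity and the Lipschitz
  -- condition below.
  have lip : ∀ u₁ u₂ v₁ v₂, upperBoundF φ u₂ v₂ ≤
      upperBoundF φ u₁ v₁ + max 0 ((u₂ : ℝ) - u₁) + max 0 ((v₂ : ℝ) - v₁) :=
    fun u₁ u₂ v₁ v₂ => upperBoundF_le hφ fun C hC h => by
      linarith [hC.le_add_max u₁ u₂ v₁ v₂, le_upperBoundF hC h.le hφ.2 u₁ v₁]
  refine ⟨fun v => const fun C hC => hC.zero_left v, fun u => const fun C hC => hC.zero_right u,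
    fun v => const fun C hC => hC.one_left v, fun u => const fun C hC => hC.one_right u,
    fun u₁ u₂ v₁ v₂ hu hv => ?_, fun u₁ u₂ v₁ v₂ => ?_⟩
  · have := lip u₂ u₁ v₂ v₁
    rwa [max_eq_left (sub_nonpos.2 (by exact_mod_cast hu)),
      max_eq_left (sub_nonpos.2 (by exact_mod_cast hv)), add_zero, add_zero] at this
  · have aux : ∀ x y : ℝ, max 0 (x - y) ≤ |x - y| := fun x y =>
      max_le (abs_nonneg _) (le_abs_self _)
    rw [abs_le]
    constructor
    · have := lip u₂ u₁ v₂ v₁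
      have h₁ := aux (u₁ : ℝ) u₂
      have h₂ := aux (v₁ : ℝ) v₂
      rw [abs_sub_comm] at h₁ h₂
      linarith
    · linarith [lip u₁ u₂ v₁ v₂, aux (u₂ : ℝ) u₁, aux (v₂ : ℝ) v₁]

/-! ### The diagonal of the bound -/

/-- Completing the square: `(2d - z)² ≤ z² + 4k`. On the diagonal, `z = 2a - 1` and `k = (1 + 2φ) /
6`. -/
theorem le_half_of_mul_le {d z k : ℝ} (h : d * (d - z) ≤ k) :
    d ≤ (z + √(z ^ 2 + 4 * k)) / 2 := by
  have : 2 * d - z ≤ √(z ^ 2 + 4 * k) := Real.le_sqrt_of_sq_le (by nlinarith)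
  linarith

theorem half_mul_eq {z k : ℝ} (hk : 0 ≤ k) :
    (z + √(z ^ 2 + 4 * k)) / 2 * ((z + √(z ^ 2 + 4 * k)) / 2 - z) = k := by
  have := Real.sq_sqrt (by positivity : 0 ≤ z ^ 2 + 4 * k)
  linear_combination this / 4

theorem upperBoundF_diag {φ : ℝ} (hφ : φ ∈ Set.Icc (-1 / 2 : ℝ) 1) (a : unitInterval) :
    upperBoundF φ a a = min (a : ℝ)
      (((2 * a - 1) + √((2 * (a : ℝ) - 1) ^ 2 + 4 * ((1 + 2 * φ) / 6))) / 2) := by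
  have hk : 0 ≤ (1 + 2 * φ) / 6 := by linarith [hφ.1]
  apply le_antisymm
  · refine upperBoundF_le hφ fun C hC h => le_min (hC.le_left a a) (le_half_of_mul_le ?_)
    have := hC.diag_mul_le a
    rw [h] at this
    linarith
  · set r := ((2 * a - 1) + √((2 * (a : ℝ) - 1) ^ 2 + 4 * ((1 + 2 * φ) / 6))) / 2 with hr
    have hs : |2 * (a : ℝ) - 1| ≤ √((2 * (a : ℝ) - 1) ^ 2 + 4 * ((1 + 2 * φ) / 6)) :=
      Real.abs_le_sqrt (by linarith)
    have hs' := abs_le.1 hs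
    have ha := a.2
    have h₀ : 0 ≤ min (a : ℝ) r := le_min ha.1 (by linarith)
    have h₁ : 2 * (a : ℝ) - 1 ≤ min (a : ℝ) r := le_min (by linarith [ha.2]) (by linarith)
    refine le_upperBoundF_of_mul_le hφ.2 le_rfl h₀ (by linarith) (min_le_left _ _) (by linarith)
      h₁ ?_
    have hm : r * (r - (2 * a - 1)) = (1 + 2 * φ) / 6 := half_mul_eq hk
    have hle := min_le_right (a : ℝ) r
    -- The product `x * (x - (2a - 1))` increases in `x` once both factors are nonnegative, and it
    -- equals `k` at `x = r`.
    nlinarith [mul_le_mul hle (sub_le_sub_right hle (2 * (a : ℝ) - 1)) (by linarith)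
      (h₀.trans hle)]

theorem upperBoundF_eq_frechetM {φ : ℝ} (hφ : φ ∈ Set.Icc (1 / 4 : ℝ) 1) :
    upperBoundF φ = frechetM := by
  have hφ' : φ ∈ Set.Icc (-1 / 2 : ℝ) 1 := ⟨by linarith [hφ.1], hφ.2⟩
  have hq := isQuasiCopula_upperBoundF hφ'
  have diag : ∀ a : unitInterval, (a : ℝ) ≤ upperBoundF φ a a := fun a => by
    rw [upperBoundF_diag hφ']
    refine le_min le_rfl (le_half_of_mul_le ?_)
    -- With `d = a` the condition is `a * (1 - a) ≤ (1 + 2φ) / 6`; the right side is at least `1/4`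
    -- exactly when `φ ≥ 1/4`.
    nlinarith [hφ.1, sq_nonneg ((a : ℝ) - 1 / 2)]
  ext a b
  refine le_antisymm (upperBoundF_le hφ' fun C hC _ => le_min (hC.le_left a b) (hC.le_right a b)) ?_
  rcases le_total a b with h | h
  · exact (min_le_left _ _).trans ((diag a).trans (hq.mono a a a b le_rfl h))
  · exact (min_le_right _ _).trans ((diag b).trans (hq.mono b a b b h le_rfl))

/-! ### The bound for the least footrule -/

/-- The two summands are the masses carried by `[0,1/2]`, moved up by `1/2`, and by `[1/2,1]`, moved
down by `1/2`. Each has the form `min (f u) (g v)` with increasing `f` and `g`, which makes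
2-increasingness immediate. -/
theorem shuffleOfM_swap_apply (u v : unitInterval) :
    shuffleOfM (n := 2) ![0, 1 / 2, 1] (Equiv.swap 0 1) (fun _ => 1) u v =
      min (min (1 / 2) (u : ℝ)) (max 0 ((v : ℝ) - 1 / 2)) +
        min (max 0 ((u : ℝ) - 1 / 2)) (min (1 / 2) (v : ℝ)) := by
  have hu := u.2
  have hv := v.2
  have s₀ : shuffledStart ![(0 : ℝ), 1 / 2, 1] (Equiv.swap (0 : Fin 2) 1) 0 = 1 / 2 := by
    have : (Finset.univ.filter fun j : Fin 2 =>
      Equiv.swap (0 : Fin 2) 1 j < Equiv.swap (0 : Fin 2) 1 0) = {1} := by decide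
    rw [shuffledStart, this]
    norm_num
  have s₁ : shuffledStart ![(0 : ℝ), 1 / 2, 1] (Equiv.swap (0 : Fin 2) 1) 1 = 0 := by
    have : (Finset.univ.filter fun j : Fin 2 =>
      Equiv.swap (0 : Fin 2) 1 j < Equiv.swap (0 : Fin 2) 1 1) = ∅ := by decide
    rw [shuffledStart, this]
    simp
  have e₀ : {x : ℝ | x ∈ Set.Icc (0 : ℝ) (1 / 2) ∧ x ≤ u ∧ 1 / 2 + (x - 0) ≤ v} =
      Set.Icc 0 (min (min (1 / 2) (u : ℝ)) (v - 1 / 2)) := by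
    ext x
    simp only [Set.mem_ofPred_eq, Set.mem_Icc, le_min_iff]
    constructor
    · rintro ⟨⟨h₁, h₂⟩, h₃, h₄⟩
      exact ⟨h₁, ⟨h₂, h₃⟩, by linarith⟩
    · rintro ⟨h₁, ⟨h₂, h₃⟩, h₄⟩
      exact ⟨⟨h₁, h₂⟩, h₃, by linarith⟩
  have e₁ : {x : ℝ | x ∈ Set.Icc (1 / 2 : ℝ) 1 ∧ x ≤ u ∧ 0 + (x - 1 / 2) ≤ v} =
      Set.Icc (1 / 2) (min (u : ℝ) (min (1 / 2) (v : ℝ) + 1 / 2)) := by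
    ext x
    simp only [Set.mem_ofPred_eq, Set.mem_Icc, le_min_iff, ← sub_le_iff_le_add]
    constructor
    · rintro ⟨⟨h₁, h₂⟩, h₃, h₄⟩
      exact ⟨h₁, h₃, by linarith, by linarith⟩
    · rintro ⟨h₁, h₂, h₃, h₄⟩
      exact ⟨⟨h₁, by linarith⟩, h₂, by linarith⟩
  have l₀ : (0 : ℝ) ≤ min (1 / 2) (u : ℝ) := le_min (by norm_num) hu.1
  have l₁ : (0 : ℝ) ≤ min (1 / 2) (v : ℝ) := le_min (by norm_num) hv.1
  have m₀ : max (min (min (1 / 2) (u : ℝ)) (v - 1 / 2) - 0) 0 =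
      min (min (1 / 2) (u : ℝ)) (max 0 ((v : ℝ) - 1 / 2)) := by
    rw [sub_zero, max_comm, max_min_distrib_left, max_eq_right l₀]
  have m₁ : max (min (u : ℝ) (min (1 / 2) (v : ℝ) + 1 / 2) - 1 / 2) 0 =
      min (max 0 ((u : ℝ) - 1 / 2)) (min (1 / 2) (v : ℝ)) := by
    rw [← min_sub_sub_right, add_sub_cancel_right, max_comm, max_min_distrib_left,
      max_eq_right l₁]
  simp only [shuffleOfM, Fin.sum_univ_two, shuffleMap, if_true, s₀, s₁]
  change volume.real {x : ℝ | x ∈ Set.Icc (0 : ℝ) (1 / 2) ∧ x ≤ u ∧ 1 / 2 + (x - 0) ≤ v} +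
    volume.real {x : ℝ | x ∈ Set.Icc (1 / 2 : ℝ) 1 ∧ x ≤ u ∧ 0 + (x - 1 / 2) ≤ v} = _
  rw [e₀, e₁, Real.volume_real_Icc, Real.volume_real_Icc, m₀, m₁]

theorem isCut_halves : IsCut (n := 2) ![0, 1 / 2, 1] where
  strictMono := by
    rw [Fin.strictMono_iff_lt_succ]
    intro i
    fin_cases i
    · simp
    · change (1 / 2 : ℝ) < 1
      norm_num
  first := rfl
  last := rfl

theorem isCopula_shuffleOfM_swap :
    IsCopula (shuffleOfM (n := 2) ![0, 1 / 2, 1] (Equiv.swap 0 1) (fun _ => 1)) where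
  zero_left v := by
    rw [shuffleOfM_swap_apply]
    have := v.2.1
    norm_num [this]
  zero_right v := by
    rw [shuffleOfM_swap_apply]
    have := v.2.1
    norm_num [this]
  one_left v := by
    rw [shuffleOfM_swap_apply]
    have := v.2.2
    have := v.2.1
    rcases le_total (v : ℝ) (1 / 2) with h | h <;> norm_num <;> grind
  one_right v := by
    rw [shuffleOfM_swap_apply]
    have := v.2.2
    have := v.2.1
    rcases le_total (v : ℝ) (1 / 2) with h | h <;> norm_num <;> grind
  two_increasing u₁ u₂ v₁ v₂ hu hv := by
    have hu' : (u₁ : ℝ) ≤ u₂ := by exact_mod_cast hu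
    have hv' : (v₁ : ℝ) ≤ v₂ := by exact_mod_cast hv
    simp only [shuffleOfM_swap_apply]
    have h₁ := two_increasing_min (min_le_min_left (1 / 2) hu')
      (max_le_max_left 0 (sub_le_sub_right hv' (1 / 2)))
    have h₂ := two_increasing_min (max_le_max_left 0 (sub_le_sub_right hu' (1 / 2)))
      (min_le_min_left (1 / 2) hv')
    linarith

theorem footrule_shuffleOfM_swap :
    footrule (shuffleOfM (n := 2) ![0, 1 / 2, 1] (Equiv.swap 0 1) (fun _ => 1)) = -1 / 2 := by
  refine footrule_eq_of_diag_eq fun t => ?_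
  rw [shuffleOfM_swap_apply]
  have := t.2.2
  have := t.2.1
  grind

theorem upperBoundF_neg_half_diag (t : unitInterval) :
    upperBoundF (-1 / 2) t t = max 0 ((t : ℝ) + t - 1) := by
  have := t.2.2
  have := t.2.1
  rw [upperBoundF_diag ⟨le_rfl, by norm_num⟩,
    show (2 * (t : ℝ) - 1) ^ 2 + 4 * ((1 + 2 * (-1 / 2)) / 6) = (2 * (t : ℝ) - 1) ^ 2 by norm_num,
    Real.sqrt_sq_eq_abs]
  grind

theorem upperBoundF_neg_half : upperBoundF (-1 / 2) =
    shuffleOfM (n := 2) ![0, 1 / 2, 1] (Equiv.swap 0 1) (fun _ => 1) := by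
  have hφ : (-1 / 2 : ℝ) ∈ Set.Icc (-1 / 2 : ℝ) 1 := ⟨le_rfl, by norm_num⟩
  -- The known diagonal controls the other points. At `t = 1/2` the diagonal vanishes; this estimate
  -- and `M` together match the shuffle on each quadrant cut out by `1/2`.
  have lip : ∀ t u v : unitInterval, upperBoundF (-1 / 2) u v ≤
      max 0 ((t : ℝ) + t - 1) + max 0 ((u : ℝ) - t) + max 0 ((v : ℝ) - t) := fun t u v =>
    upperBoundF_le hφ fun C hC h => by
      rw [← upperBoundF_neg_half_diag]
      linarith [hC.le_add_max t u t v, le_upperBoundF hC h.le hφ.2 t t]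
  ext u v
  refine le_antisymm ?_ (le_upperBoundF isCopula_shuffleOfM_swap footrule_shuffleOfM_swap.le
    hφ.2 u v)
  have h₀ := lip ⟨1 / 2, by norm_num, by norm_num⟩ u v
  have h₁ := lip u u v
  have h₂ := lip v u v
  have h₃ : upperBoundF (-1 / 2) u v ≤ min (u : ℝ) v :=
    upperBoundF_le hφ fun C hC _ => le_min (hC.le_left u v) (hC.le_right u v)
  rw [shuffleOfM_swap_apply]
  have := u.2.1
  have := u.2.2
  have := v.2.1
  have := v.2.2
  simp only at h₀
  grind

/-! ### The bound is not a copula in general -/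

/-- On the square `[1/2-ε, 1/2+ε]²` the diagonal corners contribute at most `√(4ε² + 4k)`, while the
other two contribute at least `2√(2ε² + k) = √(8ε² + 4k)`, which is larger, so the volume is
negative. -/
theorem not_isCopula_upperBoundF {φ : ℝ} (h : -1 / 2 < φ) (h' : φ < 1 / 4) :
    ¬ IsCopula (upperBoundF φ) := by
  intro hF
  have hφ : φ ∈ Set.Icc (-1 / 2 : ℝ) 1 := ⟨h.le, by linarith⟩
  obtain ⟨k, hk⟩ : ∃ k, k = (1 + 2 * φ) / 6 := ⟨_, rfl⟩
  have hk₀ : 0 < k := by linarith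
  have hk₁ : k < 1 / 4 := by linarith
  -- The bound `ε ≤ k` gives `2ε ≤ √(2ε² + k)`, and `2ε ≤ 1/4 - k` gives `√(2ε² + k) ≤ 1/2 - ε`;
  -- these are the conditions for `le_upperBoundF_of_mul_le` at `(x,y)`.
  obtain ⟨ε, hε₀, hε₁, hε₂⟩ : ∃ ε : ℝ, 0 < ε ∧ ε ≤ k ∧ 2 * ε ≤ 1 / 4 - k :=
    ⟨min k ((1 / 4 - k) / 2), lt_min hk₀ (by linarith), min_le_left _ _,
      by linarith [min_le_right k ((1 / 4 - k) / 2)]⟩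
  let x : unitInterval := ⟨1 / 2 - ε, by linarith, by linarith⟩
  let y : unitInterval := ⟨1 / 2 + ε, by linarith, by linarith⟩
  have hx : (x : ℝ) = 1 / 2 - ε := rfl
  have hy : (y : ℝ) = 1 / 2 + ε := rfl
  have hd := Real.sq_sqrt (by positivity : 0 ≤ 2 * ε ^ 2 + k)
  have hs := Real.sq_sqrt (by positivity : 0 ≤ 4 * ε ^ 2 + 4 * k)
  have hd₀ := Real.sqrt_nonneg (2 * ε ^ 2 + k)
  have hs₀ := Real.sqrt_nonneg (4 * ε ^ 2 + 4 * k)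
  have hd₁ : √(2 * ε ^ 2 + k) ≤ 1 / 2 - ε := Real.sqrt_le_iff.2 ⟨by linarith, by nlinarith⟩
  have hd₂ : 2 * ε ≤ √(2 * ε ^ 2 + k) := Real.le_sqrt_of_sq_le (by nlinarith)
  have hlt : √(4 * ε ^ 2 + 4 * k) < 2 * √(2 * ε ^ 2 + k) := by
    refine lt_of_pow_lt_pow_left₀ 2 (by positivity) ?_
    rw [mul_pow, hd, hs]
    nlinarith
  have hxx := upperBoundF_diag hφ x
  have hyy := upperBoundF_diag hφ y
  rw [← hk, hx, show (2 * (1 / 2 - ε) - 1) ^ 2 + 4 * k = 4 * ε ^ 2 + 4 * k by ring] at hxx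
  rw [← hk, hy, show (2 * (1 / 2 + ε) - 1) ^ 2 + 4 * k = 4 * ε ^ 2 + 4 * k by ring] at hyy
  have hxx' := hxx.trans_le (min_le_right _ _)
  have hyy' := hyy.trans_le (min_le_right _ _)
  -- Since `x + y = 1`, the quadratic condition reads `d² - 2ε² ≤ k`, with equality for this `d`.
  have hxy : √(2 * ε ^ 2 + k) ≤ upperBoundF φ x y := by
    refine le_upperBoundF_of_mul_le hφ.2 (by linarith) hd₀ (by linarith) (by linarith)
      (by linarith) (by linarith) ?_
    rw [hx, hy, ← hk]
    nlinarith
  have hle : x ≤ y := by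
    rw [← Subtype.coe_le_coe]
    linarith
  have := hF.two_increasing x y x y hle hle
  linarith [upperBoundF_le_swap hφ x y]

/-! ### The footrule of the bound -/

/-- With `z = 2t - 1` this is the standard primitive of `z + √(z² + 4k)`; `k > 0` keeps the argument
of the logarithm positive. -/
theorem hasDerivAt_diag_root {k : ℝ} (hk : 0 < k) (t : ℝ) :
    HasDerivAt (fun t : ℝ => ((2 * t - 1) ^ 2 + (2 * t - 1) * √((2 * t - 1) ^ 2 + 4 * k) +
      4 * k * Real.log ((2 * t - 1) + √((2 * t - 1) ^ 2 + 4 * k))) / 8)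
      (((2 * t - 1) + √((2 * t - 1) ^ 2 + 4 * k)) / 2) t := by
  have hz : HasDerivAt (fun t : ℝ => 2 * t - 1) 2 t := by
    simpa using ((hasDerivAt_id t).const_mul 2).sub_const 1
  have hpos : 0 < (2 * t - 1) ^ 2 + 4 * k := by positivity
  have hr := Real.sqrt_pos.2 hpos
  have hsq := Real.sq_sqrt hpos.le
  have hzr : 0 < (2 * t - 1) + √((2 * t - 1) ^ 2 + 4 * k) := by
    have : |2 * t - 1| < √((2 * t - 1) ^ 2 + 4 * k) := by
      rw [← Real.sqrt_sq_eq_abs]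
      exact Real.sqrt_lt_sqrt (sq_nonneg _) (by linarith)
    linarith [(abs_lt.1 this).1]
  have hs := ((hz.pow 2).add_const (4 * k)).sqrt hpos.ne'
  have hl := (hz.add hs).log hzr.ne'
  refine ((((hz.pow 2).add (hz.mul hs)).add (hl.const_mul (4 * k))).div_const 8).congr_deriv ?_
  simp only [Pi.pow_apply, Pi.add_apply]
  generalize √((2 * t - 1) ^ 2 + 4 * k) = r at *
  generalize 2 * t - 1 = z at *
  -- Eliminating `k` through the square root leaves a rational identity in `r` and `z`.
  obtain rfl : k = (r ^ 2 - z ^ 2) / 4 := by linarith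
  push_cast
  field_simp
  ring

theorem footrule_upperBoundF {φ : ℝ} (h : -1 / 2 < φ) (h' : φ ≤ 1 / 4) :
    footrule (upperBoundF φ) = 1 / 2 * (2 - √(3 - 12 * φ) + (1 + 2 * φ) *
      Real.log ((3 + √(3 - 12 * φ)) ^ 2 / (6 * (1 + 2 * φ)))) := by
  have hφ : φ ∈ Set.Icc (-1 / 2 : ℝ) 1 := ⟨h.le, by linarith⟩
  -- The two branches of the diagonal meet where `t * (1 - t) = k`, that is at `t = 1/2 ± m`.
  -- Between these points the square root branch is the smaller one; outside, the diagonal is `t`.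
  obtain ⟨m, hm⟩ : ∃ m, m = √(3 - 12 * φ) / 6 := ⟨_, rfl⟩
  have hm₀ : 0 ≤ m := by rw [hm]; positivity
  have hm' : √(3 - 12 * φ) = 6 * m := by linarith
  have hsq : (6 * m) ^ 2 = 3 - 12 * φ := by rw [← hm', Real.sq_sqrt (by linarith)]
  obtain rfl : φ = (3 - (6 * m) ^ 2) / 12 := by linarith
  have hm₁ : m < 1 / 2 := by nlinarith
  obtain ⟨k, hk⟩ : ∃ k, k = 1 / 4 - m ^ 2 := ⟨_, rfl⟩
  have hk₀ : 0 < k := by nlinarith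
  rw [hm']
  set g : ℝ → ℝ := fun t => min t (((2 * t - 1) + √((2 * t - 1) ^ 2 + 4 * k)) / 2) with hg
  have hr : Continuous fun t : ℝ => ((2 * t - 1) + √((2 * t - 1) ^ 2 + 4 * k)) / 2 := by fun_prop
  have hc : Continuous g := continuous_id.min hr
  have hi : ∀ p q, IntervalIntegrable g volume p q := fun p q => hc.intervalIntegrable p q
  have eq₁ : ∀ t : ℝ, k ≥ t * (1 - t) → g t = t := fun t ht =>
    min_eq_left (le_half_of_mul_le (by linarith))
  rw [footrule_eq_intervalIntegral (g := g) (fun t => by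
    rw [upperBoundF_diag hφ, hg]
    congr 5
    linarith)]
  have e₁ := integral_eq_of_eqOn_affine (f := g) (p := 0) (q := 1 / 2 - m) 1 0 (by linarith) (by
    rintro t ⟨ht, ht'⟩
    rw [eq₁ t (by nlinarith)]
    ring)
  have e₃ := integral_eq_of_eqOn_affine (f := g) (p := 1 / 2 + m) (q := 1) 1 0 (by linarith) (by
    rintro t ⟨ht, ht'⟩
    rw [eq₁ t (by nlinarith)]
    ring)
  have e₂ := integral_eq_of_eqOn_Icc (f := g) (p := 1 / 2 - m) (q := 1 / 2 + m) (by linarith) (by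
    rintro t ⟨ht, ht'⟩
    refine min_eq_right ?_
    have : √((2 * t - 1) ^ 2 + 4 * k) ≤ 1 := Real.sqrt_le_one.2 (by nlinarith)
    linarith) hr (hasDerivAt_diag_root hk₀)
  have r₁ : √((2 * (1 / 2 + m) - 1) ^ 2 + 4 * k) = 1 := by
    rw [hk, show (2 * (1 / 2 + m) - 1) ^ 2 + 4 * (1 / 4 - m ^ 2) = 1 by ring, Real.sqrt_one]
  have r₂ : √((2 * (1 / 2 - m) - 1) ^ 2 + 4 * k) = 1 := by
    rw [hk, show (2 * (1 / 2 - m) - 1) ^ 2 + 4 * (1 / 4 - m ^ 2) = 1 by ring, Real.sqrt_one]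
  -- The quotient `(1/2 + m) / (1/2 - m)` equals `(1/2 + m)² / k`, because `k = (1/2 + m) * (1/2 -
  -- m)`.
  have hlog : Real.log ((3 + 6 * m) ^ 2 / (6 * (1 + 2 * ((3 - (6 * m) ^ 2) / 12)))) =
      Real.log (2 * (1 / 2 + m) - 1 + 1) - Real.log (2 * (1 / 2 - m) - 1 + 1) := by
    rw [← Real.log_div (by linarith) (by linarith)]
    congr 1
    have h₁ : (2 * (1 / 2 - m) - 1 + 1) ≠ 0 := by linarith
    have h₂ : 6 * (1 + 2 * ((3 - (6 * m) ^ 2) / 12)) ≠ 0 := by nlinarith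
    rw [div_eq_div_iff h₂ h₁]
    ring
  rw [← intervalIntegral.integral_add_adjacent_intervals (hi 0 (1 / 2 - m)) (hi _ 1),
    ← intervalIntegral.integral_add_adjacent_intervals (hi _ (1 / 2 + m)) (hi _ 1),
    e₁, e₂, e₃, r₁, r₂, hlog, hk]
  ring

theorem lt_footrule_upperBoundF {φ : ℝ} (h : -1 / 2 < φ) (h' : φ < 1) :
    φ < footrule (upperBoundF φ) := by
  rcases le_total φ (1 / 4) with h₁ | h₁
  · have hs := Real.sq_sqrt (by linarith : 0 ≤ 3 - 12 * φ)
    have hs₀ := Real.sqrt_nonneg (3 - 12 * φ)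
    have hs₁ : √(3 - 12 * φ) < 3 := by nlinarith
    have hlog : 0 ≤ Real.log ((3 + √(3 - 12 * φ)) ^ 2 / (6 * (1 + 2 * φ))) := by
      refine Real.log_nonneg ?_
      rw [one_le_div (by linarith)]
      nlinarith
    rw [footrule_upperBoundF h h₁]
    -- With `s = √(3 - 12φ)`, dropping the nonnegative logarithmic term leaves `(2 - s)/2 - φ = (3 -
    -- s)² / 12 > 0`.
    nlinarith [mul_nonneg (by linarith : 0 ≤ 1 + 2 * φ) hlog,
      mul_pos (sub_pos.2 hs₁) (sub_pos.2 hs₁)]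
  · rwa [upperBoundF_eq_frechetM ⟨h₁, h'.le⟩, footrule_frechetM]

end FootruleBounds

theorem corollary6 :
    -- the bound really is the pointwise supremum of a nonempty set of copulas
    (∀ φ ∈ Set.Icc (-1 / 2 : ℝ) 1, ∀ a b : unitInterval,
      IsLUB (FootruleBounds.footruleValues φ a b) (FootruleBounds.upperBoundF φ a b)) ∧
    -- (i)
    (FootruleBounds.IsShuffleOfM (FootruleBounds.upperBoundF (-1 / 2)) ∧
      FootruleBounds.upperBoundF (-1 / 2) =
        FootruleBounds.shuffleOfM (n := 2) ![0, 1 / 2, 1] (Equiv.swap 0 1) (fun _ => 1) ∧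
      ∀ φ ∈ Set.Icc (1 / 4 : ℝ) 1, FootruleBounds.upperBoundF φ = FootruleBounds.frechetM) ∧
    -- (ii)
    (∀ φ ∈ Set.Ioo (-1 / 2 : ℝ) (1 / 4),
      FootruleBounds.IsProperQuasiCopula (FootruleBounds.upperBoundF φ)) ∧
    -- (iii)
    (∀ φ₁ ∈ Set.Icc (-1 / 2 : ℝ) 1, ∀ φ₂ ∈ Set.Icc (-1 / 2 : ℝ) 1, φ₁ ≤ φ₂ →
      FootruleBounds.ConcordanceLE (FootruleBounds.upperBoundF φ₁)
        (FootruleBounds.upperBoundF φ₂)) ∧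
    -- (iv)
    (∀ φ ∈ Set.Icc (-1 / 2 : ℝ) 1,
      FootruleBounds.transpose (FootruleBounds.upperBoundF φ) = FootruleBounds.upperBoundF φ ∧
      FootruleBounds.survival (FootruleBounds.upperBoundF φ) = FootruleBounds.upperBoundF φ) ∧
    -- (v)
    (FootruleBounds.footrule (FootruleBounds.upperBoundF (-1 / 2)) = -1 / 2 ∧
      (∀ φ ∈ Set.Ioc (-1 / 2 : ℝ) (1 / 4),
        FootruleBounds.footrule (FootruleBounds.upperBoundF φ) =
          1 / 2 * (2 - Real.sqrt (3 - 12 * φ) + (1 + 2 * φ) *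
            Real.log ((3 + Real.sqrt (3 - 12 * φ)) ^ 2 / (6 * (1 + 2 * φ))))) ∧
      (∀ φ ∈ Set.Icc (1 / 4 : ℝ) 1,
        FootruleBounds.footrule (FootruleBounds.upperBoundF φ) = 1) ∧
      ∀ φ ∈ Set.Ioo (0 : ℝ) 1,
        φ < FootruleBounds.footrule (FootruleBounds.upperBoundF φ)) := by
  open FootruleBounds in
  refine ⟨fun φ hφ a b => isLUB_upperBoundF hφ a b,
    ⟨⟨2, _, _, _, isCut_halves, upperBoundF_neg_half⟩, upperBoundF_neg_half,
      fun φ hφ => upperBoundF_eq_frechetM hφ⟩,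
    fun φ hφ => ⟨isQuasiCopula_upperBoundF ⟨hφ.1.le, by linarith [hφ.2]⟩,
      not_isCopula_upperBoundF hφ.1 hφ.2⟩,
    fun φ₁ h₁ φ₂ h₂ h => concordanceLE_upperBoundF h₁ h₂.2 h,
    fun φ hφ => ⟨transpose_upperBoundF hφ, survival_upperBoundF hφ⟩,
    footrule_eq_of_diag_eq upperBoundF_neg_half_diag,
    fun φ hφ => footrule_upperBoundF hφ.1 hφ.2,
    fun φ hφ => ?_,
    fun φ hφ => lt_footrule_upperBoundF (by linarith [hφ.1]) hφ.2⟩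
  rw [upperBoundF_eq_frechetM hφ, footrule_frechetM]
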